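/- **Model.** Fix integers $N,T,J,D,K\ge 0$, $L\ge 2$ and $M_1,\dots,M_J\ge 2$, covariates $X_n^t\in\mathbb R^{1\times D}$, the set of latent states $A_L=\{0,\dots,L-1\}^K$, and two sets $H, H_{\mathrm{tr}}\subseteq A_L$ of design components. For $u\in A_L$ let $d(u)\in\{0,1\}^{A_L}$ be the vector with entries $d(u)_h=\prod_{k=1}^K I(u_k\ge h_k)$, and let $d_u$, $d_{u,\mathrm{tr}}$ be its restrictions to $H$ and $H_{\mathrm{tr}}$. A parameter is $\theta=(\kappa,\beta,\gamma,\lambda,\xi,R)$, where - for each item $j$, $-\infty=\kappa_{j0}<\kappa_{j1}=0<\kappa_{j2}<\dots<\kappa_{jM_j}=\infty$, and $\beta_j\in\mathbb R^{H}$ satisfies $d_u\beta_j\ge d_v\beta_j$ whenever $u\ge v$ componentwise; - for each $k$, $-\infty=\gamma_{k0}<\gamma_{k1}=0<\gamma_{k2}<\dots<\gamma_{kL}=\infty$; $\lambda\in\mathbb R^{D\times K}$, $\xi\in\mathbb R^{H_{\mathrm{tr}}\times K}$; and $R\in\mathbb R^{K\times K}$ is positive definite with unit diagonal. For each respondent $n\in[N]$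 the latent states $\alpha_n^1,\dots,\alpha_n^T\in A_L$ form a Markov chain: for a state $v$, $p(\alpha_n^1=v\mid\theta)$ is the mass that the normal law $N_K(X_n^1\lambda,R)$ gives to the box $\prod_k(\gamma_{k,v_k},\gamma_{k,v_k+1}]$, and for $2\le t\le T$ the entry $(u,v)$ of the transition matrix $U_{n,t,t-1}=(p(\alpha_n^t=v\mid\alpha_n^{t-1}=u,\theta))_{u,v}$ is the mass that $N_K(X_n^t\lambda+d_{u,\mathrm{tr}}\xi,R)$ gives to the same box. Let $\pi_n^t=(p(\alpha_n^t=u\mid\theta))_{u\in A_L}$. Given the latent states, all responses $Y_{nj}^t\in\{0,\dots,M_j-1\}$ are independent, and $$p(Y_{nj}^t=m\mid\alpha_n^t=u,\theta)=\Phi(\kappa_{j,m+1}-d_u\beta_j)-\Phi(\kappa_{jm}-d_u\beta_j),$$ where $\Phi$ is the standard normal distribution function. Let $Y_n^t=(Y_{n1}^t,\dots,Y_{nJ}^t)$, and let $B$ be the $(\sum_jM_j)\times L^K$ emissions matrix of these numbers, with rows indexed by $(j,m)$ and columns by $u$. Let $\Theta$ be the set of all such $\theta$ that satisfy: - (C1)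 all entries of $\pi_n^t$ are positive, for all $n\in[N]$ and $t\in[T]$; - (C3) there are pairwise disjoint sets $J_1,J_2,J_3\subseteq[J]$ of items such that each of the three matrices $\bigl(p(Y_{n,J_i}^t=y\mid\alpha_n^t=u,\theta)\bigr)_{y,u}$, $i=1,2,3$, has rank $L^K$ (this matrix does not depend on $n,t$; its rows are indexed by the response vectors $y$ to the items in $J_i$); - (C4) $\operatorname{rank}U_{n,t,t-1}=L^K$ for all $n\in[N]$ and $2\le t\le T$. **Theorem.** Let $n\in[N]$ and $2\le t\le T-1$. Then the tuple $(U_{n,t,t-1},U_{n,t+1,t},B,\pi_n^{t-1},\pi_n^t)$ is strictly identifiable up to label swapping from the joint distribution of $(Y_n^{t-1},Y_n^t,Y_n^{t+1})$. That is, if $\theta,\widetilde\theta\in\Theta$ satisfy $$p(Y_n^{t-1}=y,\,Y_n^t=y',\,Y_n^{t+1}=y''\mid\theta)=p(Y_n^{t-1}=y,\,Y_n^t=y',\,Y_n^{t+1}=y''\mid\widetilde\theta)\quad\text{for all response vectors }y,y',y'',$$ then there is one permutation matrix $P$ of size $L^K\times L^K$ (a relabelling of the latent states) such that $$\widetilde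 U_{n,t,t-1}=P\,U_{n,t,t-1}P^{\top},\quad \widetilde U_{n,t+1,t}=P\,U_{n,t+1,t}P^{\top},\quad \widetilde B=BP^{\top},\quad \widetilde\pi_n^{t-1}=P\pi_n^{t-1},\quad \widetilde\pi_n^t=P\pi_n^t .$$ -/

import Mathlib

open MeasureTheory ProbabilityTheory

noncomputable section

/-- The fixed, known quantities of the longitudinal model: numbers of respondents `N`, time points
`T`, items `J`, response categories `M j`, covariates `D`, latent attributes `K` and attribute
levels `L`; the covariates `X n t`; and the sets of components of the saturated design vector
(main effects and interactions) used by the measurement and by the structural model. -/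
structure LongitudinalDesign where
  N : ℕ
  T : ℕ
  J : ℕ
  M : Fin J → ℕ
  D : ℕ
  K : ℕ
  L : ℕ
  X : Fin N → Fin T → Fin D → ℝ
  measEffects : Finset (Fin K → Fin L)
  transEffects : Finset (Fin K → Fin L)

namespace LongitudinalDesign

/-- Latent states (attribute profiles), `A_L = {0, …, L-1}^K`. -/
abbrev State (𝒟 : LongitudinalDesign) : Type := Fin 𝒟.K → Fin 𝒟.L

/-- Response vectors of one respondent at one time point. -/
abbrev Response (𝒟 : LongitudinalDesign) : Type := ∀ j : Fin 𝒟.J, Fin (𝒟.M j)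

/-- Cumulative coding of attribute `k`: the vector `(I(α_k ≥ 0), …, I(α_k ≥ L-1))`. -/
def coding (𝒟 : LongitudinalDesign) (k : Fin 𝒟.K) (u : 𝒟.State) (l : Fin 𝒟.L) : ℝ :=
  if l ≤ u k then 1 else 0

/-- The saturated design vector `d(α) = d_1(α) ⊗ ⋯ ⊗ d_K(α)`, indexed by multi-indices. -/
def designVector (𝒟 : LongitudinalDesign) (u : 𝒟.State) (h : Fin 𝒟.K → Fin 𝒟.L) : ℝ :=
  ∏ k, 𝒟.coding k u (h k)

/-- The parameters `θ = (θ_m, θ_s)` with `θ_m = (κ, β)` and `θ_s = (γ, λ, ξ, R)`. -/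
structure Param (𝒟 : LongitudinalDesign) where
  κ : ∀ j : Fin 𝒟.J, Fin (𝒟.M j + 1) → EReal
  β : Fin 𝒟.J → 𝒟.measEffects → ℝ
  γ : Fin 𝒟.K → Fin (𝒟.L + 1) → EReal
  lam : Matrix (Fin 𝒟.D) (Fin 𝒟.K) ℝ
  ξ : Matrix 𝒟.transEffects (Fin 𝒟.K) ℝ
  R : Matrix (Fin 𝒟.K) (Fin 𝒟.K) ℝ

end LongitudinalDesign

/-- A vector of thresholds `-∞ = c_0 < c_1 < ⋯ < c_m = ∞` with `c_1 = 0`. -/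
structure IsThresholdVector {m : ℕ} (c : Fin (m + 1) → EReal) : Prop where
  strictMono : StrictMono c
  bot : c 0 = ⊥
  zero : c 1 = 0
  top : c (Fin.last m) = ⊤

/-- The standard normal distribution function, with `Φ(-∞) = 0` and `Φ(∞) = 1`. -/
def stdNormalCDF (x : EReal) : ℝ := (gaussianReal 0 1).real {z : ℝ | (z : EReal) ≤ x}

namespace LongitudinalDesign.Param

variable {𝒟 : LongitudinalDesign}

/-! ### Measurement model -/

/-- `d_u β_j`. -/
def measPredictor (θ : 𝒟.Param) (j : Fin 𝒟.J) (u : 𝒟.State) : ℝ :=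
  ∑ h : 𝒟.measEffects, 𝒟.designVector u h * θ.β j h

/-- `p(Y_j = m | α = u) = Φ(κ_{j,m+1} - d_u β_j) - Φ(κ_{j,m} - d_u β_j)`. -/
def itemProb (θ : 𝒟.Param) (j : Fin 𝒟.J) (m : Fin (𝒟.M j)) (u : 𝒟.State) : ℝ :=
  stdNormalCDF (θ.κ j m.succ - (θ.measPredictor j u : EReal)) -
    stdNormalCDF (θ.κ j m.castSucc - (θ.measPredictor j u : EReal))

/-- The `(∑ j, M j) × L ^ K` emissions matrix `B`. -/
def emissionMatrix (θ : 𝒟.Param) : Matrix (Σ j : Fin 𝒟.J, Fin (𝒟.M j)) 𝒟.State ℝ :=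
  Matrix.of fun i u => θ.itemProb i.1 i.2 u

/-- The matrix `(p(Y_S = y | α = u))` of the response vector to the items in `S`; responses to
different items are conditionally independent given the latent state. -/
def responseMatrix (θ : 𝒟.Param) (S : Finset (Fin 𝒟.J)) :
    Matrix (∀ j : S, Fin (𝒟.M j)) 𝒟.State ℝ :=
  Matrix.of fun y u => ∏ j : S, θ.itemProb j (y j) u

/-- `p(Y = y | α = u)` for the full response vector. -/
def emissionProb (θ : 𝒟.Param) (y : 𝒟.Response) (u : 𝒟.State) : ℝ :=
  ∏ j, θ.itemProb j (y j) u

/-! ### Structural model -/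

/-- Multivariate probit probability of the state `v`: the mass which the normal law on `ℝ^K` with
mean `μ` and covariance `R` gives to the box `∏ k, (γ_{k, v_k}, γ_{k, v_k + 1}]`. -/
def probitProb (θ : 𝒟.Param) (μ : Fin 𝒟.K → ℝ) (v : 𝒟.State) : ℝ :=
  (multivariateGaussian (WithLp.toLp 2 μ) θ.R).real
    {x : EuclideanSpace ℝ (Fin 𝒟.K) |
      ∀ k, θ.γ k (v k).castSucc < (x k : EReal) ∧ (x k : EReal) ≤ θ.γ k (v k).succ}

/-- Law of the latent state at the first time point: mean `X λ`. -/
def initialProb (θ : 𝒟.Param) (n : Fin 𝒟.N) (t : Fin 𝒟.T) (v : 𝒟.State) : ℝ :=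
  θ.probitProb (fun k => ∑ i, 𝒟.X n t i * θ.lam i k) v

/-- The transition matrix `U_{n,t,t-1}` with entries `p(α^t = v | α^{t-1} = u)` (row `u`,
column `v`): probit with mean `X_n^t λ + d_u ξ`. -/
def transitionMatrix (θ : 𝒟.Param) (n : Fin 𝒟.N) (t : Fin 𝒟.T) :
    Matrix 𝒟.State 𝒟.State ℝ :=
  Matrix.of fun u v => θ.probitProb
    (fun k => (∑ i, 𝒟.X n t i * θ.lam i k) +
      ∑ h : 𝒟.transEffects, 𝒟.designVector u h * θ.ξ h k) v

/-- `p(α_n^1, …, α_n^T | θ)`; the first time point has index `0`. -/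
def pathProb (θ : 𝒟.Param) (n : Fin 𝒟.N) (a : Fin 𝒟.T → 𝒟.State) : ℝ :=
  ∏ t : Fin 𝒟.T,
    if (t : ℕ) = 0 then θ.initialProb n t (a t)
    else θ.transitionMatrix n t (a ⟨(t : ℕ) - 1, lt_of_le_of_lt (Nat.sub_le _ _) t.2⟩) (a t)

/-- `p(Y_n^1, …, Y_n^T, α_n^1, …, α_n^T | θ)`, the hidden Markov model. -/
def jointProb (θ : 𝒟.Param) (n : Fin 𝒟.N) (a : Fin 𝒟.T → 𝒟.State)
    (y : Fin 𝒟.T → 𝒟.Response) : ℝ :=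
  θ.pathProb n a * ∏ t, θ.emissionProb (y t) (a t)

/-- The marginal law `π_n^t` of the latent state at time `t`. -/
def stateProb (θ : 𝒟.Param) (n : Fin 𝒟.N) (t : Fin 𝒟.T) (u : 𝒟.State) : ℝ :=
  ∑ a : Fin 𝒟.T → 𝒟.State with a t = u, θ.pathProb n a

/-- The joint law of the responses of respondent `n` at three time points `t₀, t₁, t₂`. -/
def threeTimeLaw (θ : 𝒟.Param) (n : Fin 𝒟.N) (t₀ t₁ t₂ : Fin 𝒟.T)
    (z : 𝒟.Response × 𝒟.Response × 𝒟.Response) : ℝ :=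
  ∑ a : Fin 𝒟.T → 𝒟.State,
    ∑ y : Fin 𝒟.T → 𝒟.Response with y t₀ = z.1 ∧ y t₁ = z.2.1 ∧ y t₂ = z.2.2,
      θ.jointProb n a y

/-! ### Parameter space and conditions -/

/-- The constraints of the model: ordered normalized thresholds, monotone item predictors, and a
positive definite correlation matrix. -/
structure IsAdmissible (θ : 𝒟.Param) : Prop where
  κ_threshold : ∀ j, IsThresholdVector (θ.κ j)
  γ_threshold : ∀ k, IsThresholdVector (θ.γ k)
  monotone : ∀ j, ∀ u v : 𝒟.State, v ≤ u → θ.measPredictor j v ≤ θ.measPredictor j u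
  R_posDef : θ.R.PosDef
  R_diag : ∀ k, θ.R k k = 1

/-- All marginal latent state probabilities are positive. -/
def PositiveStates (θ : 𝒟.Param) : Prop :=
  ∀ (n : Fin 𝒟.N) (t : Fin 𝒟.T) (u : 𝒟.State), 0 < θ.stateProb n t u

/-- There are three disjoint sets of items whose conditional response probability matrices
`(p(Y_S = y | α = u))` all have rank `L ^ K`. The rows of `B` that belong to the items in `S` are
sums of rows of this matrix, so the condition holds in particular when the three corresponding
blocks of rows of `B` have rank `L ^ K`. -/
def ThreeFullRankBlocks (θ : 𝒟.Param) : Prop :=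
  ∃ J₁ J₂ J₃ : Finset (Fin 𝒟.J), Disjoint J₁ J₂ ∧ Disjoint J₁ J₃ ∧ Disjoint J₂ J₃ ∧
    (θ.responseMatrix J₁).rank = 𝒟.L ^ 𝒟.K ∧ (θ.responseMatrix J₂).rank = 𝒟.L ^ 𝒟.K ∧
    (θ.responseMatrix J₃).rank = 𝒟.L ^ 𝒟.K

/-- All transition matrices have full rank `L ^ K`. -/
def FullRankTransitions (θ : 𝒟.Param) : Prop :=
  ∀ (n : Fin 𝒟.N) (t : Fin 𝒟.T), (t : ℕ) ≠ 0 → (θ.transitionMatrix n t).rank = 𝒟.L ^ 𝒟.K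

end LongitudinalDesign.Param

/-- The parameter space: admissible parameters with positive state probabilities, three
full rank blocks of items and full rank transition matrices. -/
def LongitudinalDesign.paramSpace (𝒟 : LongitudinalDesign) : Set 𝒟.Param :=
  {θ | θ.IsAdmissible ∧ θ.PositiveStates ∧ θ.ThreeFullRankBlocks ∧ θ.FullRankTransitions}

/-! ### Identifiability -/

/-- The tuple `(U_{n,t,t-1}, U_{n,t+1,t}, B, π_n^{t-1}, π_n^t)`. -/
@[ext] structure LongitudinalDesign.LocalTuple (𝒟 : LongitudinalDesign) where
  U : Matrix 𝒟.State 𝒟.State ℝ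
  Unext : Matrix 𝒟.State 𝒟.State ℝ
  B : Matrix (Σ j : Fin 𝒟.J, Fin (𝒟.M j)) 𝒟.State ℝ
  piPrev : 𝒟.State → ℝ
  piCur : 𝒟.State → ℝ

/-- The tuple of respondent `n` at the middle one, `t₁`, of three consecutive times. -/
def LongitudinalDesign.Param.localTuple {𝒟 : LongitudinalDesign} (θ : 𝒟.Param) (n : Fin 𝒟.N)
    (t₀ t₁ t₂ : Fin 𝒟.T) : 𝒟.LocalTuple where
  U := θ.transitionMatrix n t₁
  Unext := θ.transitionMatrix n t₂
  B := θ.emissionMatrix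
  piPrev := θ.stateProb n t₀
  piCur := θ.stateProb n t₁

/-- Label swapping: one permutation of the latent states, the same for all five components,
permutes rows and columns of the transition matrices, the columns of `B` and the entries of the
probability vectors. -/
def LongitudinalDesign.labelSwap (𝒟 : LongitudinalDesign) : Setoid 𝒟.LocalTuple where
  r a b := ∃ σ : Equiv.Perm 𝒟.State,
    b.U = a.U.submatrix σ σ ∧ b.Unext = a.Unext.submatrix σ σ ∧ b.B = a.B.submatrix id σ ∧
    b.piPrev = a.piPrev ∘ σ ∧ b.piCur = a.piCur ∘ σ
  iseqv :=
    { refl := fun a => ⟨Equiv.refl _, by simp⟩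
      symm := by
        rintro a b ⟨σ, h1, h2, h3, h4, h5⟩
        refine ⟨σ.symm, ?_⟩
        simp [h1, h2, h3, h4, h5, Function.comp_assoc]
      trans := by
        rintro a b c ⟨σ, h1, h2, h3, h4, h5⟩ ⟨τ, k1, k2, k3, k4, k5⟩
        refine ⟨τ.trans σ, ?_⟩
        simp [h1, h2, h3, h4, h5, k1, k2, k3, k4, k5, Function.comp_assoc] }

/-- The parameter `τ` is strictly identifiable from the family of probability mass functions
`{f θ ; θ ∈ Θ}` up to the equivalence relation `E`. -/
def StrictlyIdentifiable {P A Y : Type*} (Θ : Set P) (f : P → Y → ℝ) (τ : P → A)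
    (E : Setoid A) : Prop :=
  ∀ θ ∈ Θ, ∀ θ' ∈ Θ, (∀ y, f θ y = f θ' y) → E (τ θ) (τ θ')

end

/-! ### Matrices of full column rank and the uniqueness of triple decompositions -/

/-! Given the middle state `v`, the Markov property makes the three responses independent, so the
three-time law is a triple product `∑ v, F y v * E y' v * G y'' v`. Here `E` is the full response
matrix, `F = E * (diagonal π * U)` describes the past and `G = E * Unextᵀ` the future
(`threeTimeLaw_eq_sum_mul`). Full-rank blocks, invertible transitions and positive state
probabilities give all three factors left inverses; rank enters only in this form.

Such a decomposition is unique up to one permutation (`exists_perm_of_triple_decomposition`). Fixing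
the middle response gives slices `F * diagonal (E y) * Gᵀ`; cancelling `F` and `G` shows that the
diagonal families of the two parameters are simultaneously similar. A column of `E` lists joint
eigenvalues, so the columns of `E'` are those of `E` in another order, and the other factors follow.

No scaling ambiguity survives, since `E` and `G` have unit column sums. The tuple is then read off:
`B` by marginalising `E`, the current state law from the column sums of `F`, and, after cancelling
`E'`, the previous state law and both transition matrices. -/

theorem Matrix.exists_mul_eq_one_of_rank_eq_card {m n : Type*} [Fintype m] [Fintype n]
    [DecidableEq m] [DecidableEq n] {A : Matrix m n ℝ} (h : A.rank = Fintype.card n) :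
    ∃ X : Matrix n m ℝ, X * A = 1 := by
  have hsurj : Function.Surjective A.transpose.mulVec := by
    have htop : LinearMap.range A.transpose.mulVecLin = ⊤ := by
      apply Submodule.eq_top_of_finrank_eq
      rw [Module.finrank_fintype_fun_eq_card, ← h, ← Matrix.rank_transpose]
      rfl
    exact LinearMap.range_eq_top.mp htop
  obtain ⟨B, hB⟩ := Matrix.mulVec_surjective_iff_exists_right_inverse.mp hsurj
  refine ⟨B.transpose, ?_⟩
  rw [← Matrix.transpose_inj, Matrix.transpose_mul, Matrix.transpose_transpose, hB,
    Matrix.transpose_one]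

theorem Matrix.mulVec_injective_of_mul_eq_one {m n : Type*} [Fintype m] [Fintype n]
    [DecidableEq n] {A : Matrix m n ℝ} (h : ∃ X : Matrix n m ℝ, X * A = 1) {x y : n → ℝ}
    (hxy : A.mulVec x = A.mulVec y) : x = y := by
  obtain ⟨X, hX⟩ := h
  simpa [hX] using congrArg X.mulVec hxy

/-- If two triple decompositions agree, then the columns of the second factors correspond. -/
theorem exists_column_match {Y S : Type*} [Fintype Y] [Fintype S] [DecidableEq S]
    {F E G F' E' G' : Matrix Y S ℝ} (hF : ∃ X : Matrix S Y ℝ, X * F = 1)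
    (hG : ∃ X : Matrix S Y ℝ, X * G = 1)
    (hE1 : ∀ v, ∑ y, E y v = 1) (hE1' : ∀ v, ∑ y, E' y v = 1)
    (h : ∀ y y' y'', ∑ v, F y v * E y' v * G y'' v = ∑ v, F' y v * E' y' v * G' y'' v) (u : S) :
    ∃ v, ∀ y, E' y u = E y v := by
  obtain ⟨X, hX⟩ := hF
  obtain ⟨Z, hZ⟩ := hG
  have hZ' : G.transpose * Z.transpose = 1 := by
    rw [← Matrix.transpose_mul, hZ, Matrix.transpose_one]
  set Q := X * F' with hQ
  set R := G'.transpose * Z.transpose with hR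
  -- The slices at a fixed middle response `y` are matrix products with a diagonal core.
  have key : ∀ y, F * Matrix.diagonal (E y) * G.transpose =
      F' * Matrix.diagonal (E' y) * G'.transpose := by
    intro y
    ext i k
    simpa [Matrix.mul_apply, Matrix.diagonal_apply] using h i y k
  have hdiag : ∀ y, Matrix.diagonal (E y) = Q * Matrix.diagonal (E' y) * R := by
    intro y
    calc Matrix.diagonal (E y) = (X * F) * Matrix.diagonal (E y) * (G.transpose * Z.transpose) := by
          rw [hX, hZ', one_mul, mul_one]
      _ = X * (F * Matrix.diagonal (E y) * G.transpose) * Z.transpose := by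
          simp only [Matrix.mul_assoc]
      _ = Q * Matrix.diagonal (E' y) * R := by
          rw [key y, hQ, hR]; simp only [Matrix.mul_assoc]
  have hsum : ∀ A : Matrix Y S ℝ, (∀ v, ∑ y, A y v = 1) →
      ∑ y, Matrix.diagonal (A y) = (1 : Matrix S S ℝ) := by
    intro A hA
    ext i k
    rw [Matrix.sum_apply]
    by_cases hik : i = k
    · subst hik; simp [hA]
    · simp [hik]
  -- Summing over `y` turns both diagonal families into the identity, so `Q` and `R` are mutually
  -- inverse and the relation is a similarity.
  have hQR : Q * R = 1 := by
    have := Finset.sum_congr rfl fun y (_ : y ∈ Finset.univ) => hdiag y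
    rw [hsum E hE1, ← Finset.sum_mul, ← Finset.mul_sum, hsum E' hE1', mul_one] at this
    exact this.symm
  have hRQ : R * Q = 1 := mul_eq_one_comm.mp hQR
  have hcomm : ∀ y, Matrix.diagonal (E y) * Q = Q * Matrix.diagonal (E' y) := by
    intro y
    rw [hdiag y, Matrix.mul_assoc, hRQ, mul_one]
  -- An invertible `Q` has no zero column. At a nonzero entry `(v, u)`, the intertwining relation
  -- `hcomm` equates the eigenvalues for all `y` with the same `v`.
  have hne : ∃ v, Q v u ≠ 0 := by
    by_contra! hzero
    have := congrFun (congrFun hRQ u) u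
    simp [Matrix.mul_apply, hzero] at this
  obtain ⟨v, hv⟩ := hne
  refine ⟨v, fun y => ?_⟩
  have := congrFun (congrFun (hcomm y) v) u
  rw [Matrix.diagonal_mul, Matrix.mul_diagonal, mul_comm] at this
  exact (mul_left_cancel₀ hv this).symm

/-- Uniqueness, up to a permutation of the terms, of a triple decomposition with factors of full
column rank. -/
theorem exists_perm_of_triple_decomposition {Y S : Type*} [Fintype Y] [Fintype S] [DecidableEq S]
    {F E G F' E' G' : Matrix Y S ℝ} (hF : ∃ X : Matrix S Y ℝ, X * F = 1)
    (hE : ∃ X : Matrix S Y ℝ, X * E = 1) (hG : ∃ X : Matrix S Y ℝ, X * G = 1)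
    (hE' : ∃ X : Matrix S Y ℝ, X * E' = 1)
    (hE1 : ∀ v, ∑ y, E y v = 1) (hE1' : ∀ v, ∑ y, E' y v = 1)
    (hG1 : ∀ v, ∑ y, G y v = 1) (hG1' : ∀ v, ∑ y, G' y v = 1)
    (hFpos : ∀ v, 0 < ∑ y, F y v)
    (h : ∀ y y' y'', ∑ v, F y v * E y' v * G y'' v = ∑ v, F' y v * E' y' v * G' y'' v) :
    ∃ σ : Equiv.Perm S, F' = F.submatrix id σ ∧ E' = E.submatrix id σ ∧ G' = G.submatrix id σ := by
  choose f hf using exists_column_match hF hG hE1 hE1' h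
  -- Two labels with the same image would give `E'` two equal columns, against its left inverse.
  have hinj : Function.Injective f := by
    intro u v huv
    have hcol : E'.mulVec (Pi.single u 1) = E'.mulVec (Pi.single v 1) := by
      ext y
      simp [hf, huv]
    have := congrFun (Matrix.mulVec_injective_of_mul_eq_one hE' hcol) u
    by_contra hne
    simp [hne] at this
  let σ : Equiv.Perm S := Equiv.ofBijective f (Finite.injective_iff_bijective.mp hinj)
  have hσ : ∀ y u, E' y u = E y (σ u) := fun y u => hf u y
  have hprod : ∀ y y'' v, F y (σ v) * G y'' (σ v) = F' y v * G' y'' v := by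
    intro y y'' v
    -- With `y` and `y''` fixed, the law is `E` applied to the vector of products of outer factors;
    -- injectivity of `E` recovers each product.
    have hvec : E.mulVec (fun v => F y v * G y'' v) =
        E.mulVec (fun v => F' y (σ.symm v) * G' y'' (σ.symm v)) := by
      ext y'
      have hr : ∑ v, F' y v * E' y' v * G' y'' v =
          ∑ v, E y' v * (F' y (σ.symm v) * G' y'' (σ.symm v)) := by
        rw [← Equiv.sum_comp σ fun v => E y' v * (F' y (σ.symm v) * G' y'' (σ.symm v))]
        refine Finset.sum_congr rfl fun v _ => ?_
        rw [hσ, Equiv.symm_apply_apply]; ring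
      simp only [Matrix.mulVec, dotProduct]
      rw [← hr, ← h]
      exact Finset.sum_congr rfl fun v _ => by ring
    simpa using congrFun (Matrix.mulVec_injective_of_mul_eq_one hE hvec) (σ v)
  have hFσ : ∀ y v, F' y v = F y (σ v) := by
    intro y v
    -- Summing out `y''` removes `G` and `G'`, whose columns sum to one, and isolates `F`.
    have := Finset.sum_congr rfl fun y'' (_ : y'' ∈ Finset.univ) => hprod y y'' v
    rw [← Finset.mul_sum, ← Finset.mul_sum, hG1, hG1', mul_one, mul_one] at this
    exact this.symm
  refine ⟨σ, by ext y v; exact hFσ y v, by ext y v; exact hσ y v, ?_⟩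
  ext y'' v
  have := Finset.sum_congr rfl fun y (_ : y ∈ Finset.univ) => hprod y y'' v
  simp only [hFσ] at this
  rw [← Finset.sum_mul, ← Finset.sum_mul] at this
  exact (mul_left_cancel₀ (hFpos _).ne' this).symm

/-! ### Marginals of product weights and of Markov chains -/

/-- The constraint cuts out a product set, so the sum factors over coordinates and each free one
contributes 1. It serves to marginalise both over items and over times. -/
theorem sum_filter_prod_eq_prod {ι : Type*} [Fintype ι] [DecidableEq ι] {α : ι → Type*}
    [∀ i, Fintype (α i)] [∀ i, DecidableEq (α i)] (f : ∀ i, α i → ℝ) (s : Finset ι)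
    (c : ∀ i, α i) (hf : ∀ i ∉ s, ∑ x, f i x = 1) :
    ∑ y : ∀ i, α i with ∀ i ∈ s, y i = c i, ∏ i, f i (y i) = ∏ i ∈ s, f i (c i) := by
  have hfilter : (Finset.univ.filter fun y : ∀ i, α i => ∀ i ∈ s, y i = c i) =
      Fintype.piFinset fun i => if i ∈ s then {c i} else Finset.univ := by
    ext y
    simp only [Finset.mem_filter, Finset.mem_univ, true_and, Fintype.mem_piFinset]
    refine forall_congr' fun i => ?_
    by_cases hi : i ∈ s <;> simp [hi]
  rw [hfilter, ← Finset.prod_univ_sum, ← Finset.prod_subset (Finset.subset_univ s)]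
  · exact Finset.prod_congr rfl fun i hi => by simp [hi]
  · intro i _ hi
    simp [hi, hf i hi]

/-- The weight of the path `a` of length `T` of the Markov chain with initial weights `init` and
transition weights `U t` into time `t`. -/
noncomputable def chainWeight {S : Type*} (init : S → ℝ) (U : ℕ → S → S → ℝ) (T : ℕ)
    (a : Fin T → S) : ℝ :=
  ∏ t : Fin T, if (t : ℕ) = 0 then init (a t)
    else U t (a ⟨(t : ℕ) - 1, lt_of_le_of_lt (Nat.sub_le _ _) t.2⟩) (a t)

theorem sum_fin_succ_fun {S : Type*} [Fintype S] (m : ℕ) (f : (Fin (m + 1) → S) → ℝ) :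
    ∑ a, f a = ∑ a : Fin m → S, ∑ x, f (Fin.snoc a x : Fin (m + 1) → S) := by
  rw [← Equiv.sum_comp (Fin.snocEquiv fun _ : Fin (m + 1) => S), Fintype.sum_prod_type_right]
  rfl

section Chain

variable {S : Type*} (init : S → ℝ) (U : ℕ → S → S → ℝ)

theorem chainWeight_snoc (m : ℕ) (a : Fin (m + 1) → S) (x : S) :
    chainWeight init U (m + 2) (Fin.snoc a x : Fin (m + 2) → S) =
      chainWeight init U (m + 1) a * U (m + 1) (a (Fin.last m)) x := by
  unfold chainWeight
  rw [Fin.prod_univ_castSucc]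
  congr 1
  · refine Finset.prod_congr rfl fun t _ => ?_
    have h1 : (Fin.snoc a x : Fin (m + 2) → S) t.castSucc = a t := by simp
    have h2 : (Fin.snoc a x : Fin (m + 2) → S)
        ⟨(t.castSucc : ℕ) - 1, lt_of_le_of_lt (Nat.sub_le _ _) t.castSucc.2⟩ =
        a ⟨(t : ℕ) - 1, lt_of_le_of_lt (Nat.sub_le _ _) t.2⟩ :=
      Fin.snoc_castSucc (α := fun _ => S) x a ⟨(t : ℕ) - 1, lt_of_le_of_lt (Nat.sub_le _ _) t.2⟩
    rw [h1, h2]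
    rfl
  · have h2 : (Fin.snoc a x : Fin (m + 2) → S)
        ⟨((Fin.last (m + 1) : Fin (m + 2)) : ℕ) - 1,
          lt_of_le_of_lt (Nat.sub_le _ _) (Fin.last (m + 1)).2⟩ = a (Fin.last m) :=
      Fin.snoc_castSucc (α := fun _ => S) x a (Fin.last m)
    rw [h2]
    simp

variable [Fintype S]

/-- The last state can be summed out whenever `F` ignores it, because transition rows sum to one;
induction removes the whole future. -/
theorem sum_chainWeight_castLE (hU : ∀ t u, ∑ v, U t u v = 1) (m k : ℕ) (hmk : m ≤ k)
    (F : (Fin (m + 1) → S) → ℝ) :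
    ∑ a : Fin (k + 1) → S, chainWeight init U (k + 1) a *
        F (fun i => a (Fin.castLE (Nat.succ_le_succ hmk) i)) =
      ∑ a : Fin (m + 1) → S, chainWeight init U (m + 1) a * F a := by
  induction k, hmk using Nat.le_induction with
  | base => rfl
  | succ k hmk ih =>
    rw [sum_fin_succ_fun, ← ih]
    refine Finset.sum_congr rfl fun a _ => ?_
    have hc : ∀ x, (fun i : Fin (m + 1) => (Fin.snoc a x : Fin (k + 2) → S)
        (Fin.castLE (Nat.succ_le_succ (Nat.le_succ_of_le hmk)) i)) =
        fun i => a (Fin.castLE (Nat.succ_le_succ hmk) i) := fun x => funext fun i =>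
      Fin.snoc_castSucc (α := fun _ => S) x a (Fin.castLE (Nat.succ_le_succ hmk) i)
    simp only [chainWeight_snoc, hc]
    rw [← Finset.sum_mul, ← Finset.mul_sum, hU, mul_one]

variable [DecidableEq S]

/-- The law of the state at time `m`. -/
noncomputable def chainMarginal (m : ℕ) (u : S) : ℝ :=
  ∑ a : Fin (m + 1) → S, chainWeight init U (m + 1) a * if a (Fin.last m) = u then 1 else 0

theorem sum_chainWeight_last (m : ℕ) (g : S → ℝ) :
    ∑ a : Fin (m + 1) → S, chainWeight init U (m + 1) a * g (a (Fin.last m)) =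
      ∑ u, chainMarginal init U m u * g u := by
  simp only [chainMarginal, Finset.sum_mul]
  rw [Finset.sum_comm]
  refine Finset.sum_congr rfl fun a _ => ?_
  simp

theorem chainMarginal_succ (m : ℕ) (v : S) :
    chainMarginal init U (m + 1) v = ∑ u, chainMarginal init U m u * U (m + 1) u v := by
  rw [chainMarginal, sum_fin_succ_fun, ← sum_chainWeight_last]
  refine Finset.sum_congr rfl fun a _ => ?_
  simp [chainWeight_snoc]

theorem sum_chainWeight_coord (hU : ∀ t u, ∑ v, U t u v = 1) (T m : ℕ) (hm : m < T)
    (g : S → ℝ) :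
    ∑ a : Fin T → S, chainWeight init U T a * g (a ⟨m, hm⟩) =
      ∑ u, chainMarginal init U m u * g u := by
  obtain ⟨k, rfl⟩ : ∃ k, T = k + 1 := ⟨T - 1, by omega⟩
  rw [← sum_chainWeight_last]
  exact sum_chainWeight_castLE init U hU m k (by omega) fun a => g (a (Fin.last m))

/-- After the future beyond `m + 2` is dropped, peeling off the last two states leaves a path ending
at `m`, which enters only through its marginal. -/
theorem sum_chainWeight_three (hU : ∀ t u, ∑ v, U t u v = 1) (T m : ℕ) (hm : m + 2 < T)
    (f : S → S → S → ℝ) :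
    ∑ a : Fin T → S, chainWeight init U T a *
        f (a ⟨m, by omega⟩) (a ⟨m + 1, by omega⟩) (a ⟨m + 2, hm⟩) =
      ∑ u, chainMarginal init U m u *
        ∑ v, U (m + 1) u v * ∑ w, U (m + 2) v w * f u v w := by
  obtain ⟨k, rfl⟩ : ∃ k, T = k + 1 := ⟨T - 1, by omega⟩
  have h := sum_chainWeight_castLE init U hU (m + 2) k (by omega) fun a =>
    f (a ⟨m, by omega⟩) (a ⟨m + 1, by omega⟩) (a ⟨m + 2, by omega⟩)
  refine h.trans ?_
  rw [sum_fin_succ_fun, sum_fin_succ_fun, ← sum_chainWeight_last]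
  refine Finset.sum_congr rfl fun a _ => ?_
  rw [Finset.mul_sum]
  refine Finset.sum_congr rfl fun v _ => ?_
  rw [Finset.mul_sum, Finset.mul_sum]
  refine Finset.sum_congr rfl fun w _ => ?_
  have e0 : (Fin.snoc (Fin.snoc a v : Fin (m + 2) → S) w : Fin (m + 3) → S) ⟨m, by omega⟩ =
      a (Fin.last m) :=
    (Fin.snoc_castSucc (α := fun _ => S) w (Fin.snoc a v : Fin (m + 2) → S)
      (Fin.last m).castSucc).trans (Fin.snoc_castSucc (α := fun _ => S) v a (Fin.last m))
  have e1 : (Fin.snoc (Fin.snoc a v : Fin (m + 2) → S) w : Fin (m + 3) → S) ⟨m + 1, by omega⟩ =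
      v :=
    (Fin.snoc_castSucc (α := fun _ => S) w (Fin.snoc a v : Fin (m + 2) → S)
      (Fin.last (m + 1))).trans (Fin.snoc_last (α := fun _ => S) v a)
  have e2 : (Fin.snoc (Fin.snoc a v : Fin (m + 2) → S) w : Fin (m + 3) → S) ⟨m + 2, by omega⟩ =
      w := Fin.snoc_last (α := fun _ => S) w (Fin.snoc a v : Fin (m + 2) → S)
  rw [e0, e1, e2, chainWeight_snoc, chainWeight_snoc, Fin.snoc_last]
  ring

end Chain

/-! ### Normalization of the item and transition probabilities -/

theorem IsThresholdVector.one_le {m : ℕ} {c : Fin (m + 1) → EReal} (hc : IsThresholdVector c) :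
    1 ≤ m := by
  rcases Nat.eq_zero_or_pos m with rfl | h
  · have := hc.bot.symm.trans hc.top
    simp at this
  · exact h

theorem IsThresholdVector.exists_mem_Ioc {m : ℕ} {c : Fin (m + 1) → EReal}
    (hc : IsThresholdVector c) (x : ℝ) :
    ∃! l : Fin m, c l.castSucc < (x : EReal) ∧ (x : EReal) ≤ c l.succ := by
  have hex : ∃ l : Fin m, c l.castSucc < (x : EReal) ∧ (x : EReal) ≤ c l.succ := by
    -- If no cell contained `x`, induction would push every threshold below `x`, including the last
    -- one, `⊤`.
    by_contra! hno
    have hlt : ∀ i : Fin (m + 1), c i < (x : EReal) := by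
      intro i
      induction i using Fin.induction with
      | zero => rw [hc.bot]; exact EReal.bot_lt_coe x
      | succ i ih => exact hno i ih
    have := hlt (Fin.last m)
    rw [hc.top] at this
    exact not_top_lt this
  obtain ⟨l, hl⟩ := hex
  refine ⟨l, hl, fun k hk => ?_⟩
  have h1 := hc.strictMono.lt_iff_lt.mp (hl.1.trans_le hk.2)
  have h2 := hc.strictMono.lt_iff_lt.mp (hk.1.trans_le hl.2)
  simp only [Fin.lt_def, Fin.val_castSucc, Fin.val_succ] at h1 h2
  exact Fin.ext (by omega)

theorem stdNormalCDF_top : stdNormalCDF ⊤ = 1 := by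
  simp [stdNormalCDF]

theorem stdNormalCDF_bot : stdNormalCDF ⊥ = 0 := by
  simp [stdNormalCDF]

namespace LongitudinalDesign.Param

variable {𝒟 : LongitudinalDesign} {θ : 𝒟.Param}

theorem sum_itemProb {j : Fin 𝒟.J} (h : IsThresholdVector (θ.κ j)) (u : 𝒟.State) :
    ∑ m, θ.itemProb j m u = 1 := by
  set g : Fin (𝒟.M j + 1) → ℝ := fun i =>
    stdNormalCDF (θ.κ j i - (θ.measPredictor j u : EReal)) with hg
  -- Telescoping: splitting off the first or the last term of the same sum leaves only `g 0` and `g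
  -- (Fin.last _)`.
  have h1 := Fin.sum_univ_succ g
  rw [Fin.sum_univ_castSucc] at h1
  have h0 : g 0 = 0 := by simp [hg, h.bot, stdNormalCDF_bot]
  have hl : g (Fin.last _) = 1 := by simp [hg, h.top, stdNormalCDF_top]
  have h2 : ∑ m, θ.itemProb j m u = ∑ m : Fin (𝒟.M j), g m.succ - ∑ m : Fin (𝒟.M j), g m.castSucc :=
    Finset.sum_sub_distrib ..
  rw [h2]
  linarith

theorem sum_emissionProb (h : ∀ j, IsThresholdVector (θ.κ j)) (u : 𝒟.State) :
    ∑ y, θ.emissionProb y u = 1 := by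
  have := sum_filter_prod_eq_prod (fun j m => θ.itemProb j m u) ∅
    -- The values are never compared with anything, since no coordinate is fixed; `one_le` only
    -- guarantees that category 0 exists.
    (fun j => ⟨0, (h j).one_le⟩) (fun j _ => sum_itemProb (h j) u)
  simpa [emissionProb] using this

theorem sum_emissionProb_item (h : ∀ j, IsThresholdVector (θ.κ j)) (j : Fin 𝒟.J)
    (m : Fin (𝒟.M j)) (u : 𝒟.State) :
    ∑ y with y j = m, θ.emissionProb y u = θ.itemProb j m u := by
  have := sum_filter_prod_eq_prod (fun j m => θ.itemProb j m u) {j}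
    (Function.update (fun j => ⟨0, (h j).one_le⟩) j m) (fun j _ => sum_itemProb (h j) u)
  simpa [emissionProb] using this

/-- The matrix `(p(Y = y | α = u))` of the full response vector. -/
noncomputable def fullResponseMatrix (θ : 𝒟.Param) : Matrix 𝒟.Response 𝒟.State ℝ :=
  Matrix.of fun y u => θ.emissionProb y u

theorem card_state (𝒟 : LongitudinalDesign) : Fintype.card 𝒟.State = 𝒟.L ^ 𝒟.K := by
  simp

/-- Marginalising to the items in `S` is left multiplication by a 0/1 matrix, so a left inverse for
the block yields one for the full matrix. -/
theorem responseMatrix_eq_mul (h : ∀ j, IsThresholdVector (θ.κ j)) (S : Finset (Fin 𝒟.J)) :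
    θ.responseMatrix S =
      (Matrix.of fun (z : ∀ j : S, Fin (𝒟.M j)) (y : 𝒟.Response) =>
        if ∀ j : S, y j = z j then (1 : ℝ) else 0) * θ.fullResponseMatrix := by
  ext z u
  have := sum_filter_prod_eq_prod (fun j m => θ.itemProb j m u) S
    (fun j => if hj : j ∈ S then z ⟨j, hj⟩ else ⟨0, (h j).one_le⟩) (fun j _ => sum_itemProb (h j) u)
  rw [Finset.sum_filter, ← Finset.prod_coe_sort S] at this
  have hz : ∏ j : S, θ.itemProb j (if hj : (j : Fin 𝒟.J) ∈ S then z ⟨j, hj⟩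
      else ⟨0, (h j).one_le⟩) u = ∏ j : S, θ.itemProb j (z j) u :=
    Finset.prod_congr rfl fun j _ => by rw [dif_pos j.2]
  rw [hz] at this
  change ∏ j : S, θ.itemProb j (z j) u = _
  rw [Matrix.mul_apply, ← this]
  refine Finset.sum_congr rfl fun y _ => ?_
  rw [Matrix.of_apply, ite_mul, one_mul, zero_mul]
  by_cases hy : ∀ j : S, y j = z j
  · rw [if_pos hy, if_pos fun j hj => by rw [dif_pos hj]; exact hy ⟨j, hj⟩]
    rfl
  · rw [if_neg hy, if_neg fun hy' => hy fun j => by simpa using hy' j j.2]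

theorem exists_mul_fullResponseMatrix_eq_one (h : ∀ j, IsThresholdVector (θ.κ j))
    (hB : θ.ThreeFullRankBlocks) :
    ∃ X : Matrix 𝒟.State 𝒟.Response ℝ, X * θ.fullResponseMatrix = 1 := by
  obtain ⟨S, -, -, -, -, -, hS, -, -⟩ := hB
  obtain ⟨X, hX⟩ := Matrix.exists_mul_eq_one_of_rank_eq_card (hS.trans (card_state 𝒟).symm)
  rw [responseMatrix_eq_mul h, ← Matrix.mul_assoc] at hX
  exact ⟨_, hX⟩

/-- The threshold boxes partition the space, and the normal law is a probability measure. -/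
theorem sum_probitProb (h : ∀ k, IsThresholdVector (θ.γ k)) (μ : Fin 𝒟.K → ℝ) :
    ∑ v, θ.probitProb μ v = 1 := by
  unfold probitProb
  set P := multivariateGaussian (WithLp.toLp 2 μ) θ.R
  rw [← measureReal_iUnion_fintype]
  · have huniv : (⋃ v : 𝒟.State, {x : EuclideanSpace ℝ (Fin 𝒟.K) |
        ∀ k, θ.γ k (v k).castSucc < (x k : EReal) ∧ (x k : EReal) ≤ θ.γ k (v k).succ}) =
        Set.univ := by
      rw [Set.eq_univ_iff_forall]
      intro x
      choose v hv using fun k => ((h k).exists_mem_Ioc (x k)).exists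
      exact Set.mem_iUnion.mpr ⟨v, hv⟩
    rw [huniv, probReal_univ]
  · intro v w hvw
    refine Set.disjoint_left.mpr fun x hx hy => hvw ?_
    exact funext fun k => ((h k).exists_mem_Ioc (x k)).unique (hx k) (hy k)
  · intro v
    simp only [Set.ofPred_forall, Set.ofPred_and]
    refine MeasurableSet.iInter fun k => ?_
    have hm : Measurable fun x : EuclideanSpace ℝ (Fin 𝒟.K) => ((x k : ℝ) : EReal) :=
      measurable_coe_real_ereal.comp (by fun_prop)
    exact (measurableSet_lt measurable_const hm).inter (measurableSet_le hm measurable_const)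

/-! ### The hidden Markov chain -/

/-- The transition weights into time `t`, indexed by natural numbers. -/
noncomputable def transitionWeight (θ : 𝒟.Param) (n : Fin 𝒟.N) (t : ℕ) (u v : 𝒟.State) : ℝ :=
  if h : t < 𝒟.T then θ.transitionMatrix n ⟨t, h⟩ u v else (1 : Matrix 𝒟.State 𝒟.State ℝ) u v

theorem sum_transitionMatrix (h : ∀ k, IsThresholdVector (θ.γ k)) (n : Fin 𝒟.N) (t : Fin 𝒟.T)
    (u : 𝒟.State) : ∑ v, θ.transitionMatrix n t u v = 1 :=
  sum_probitProb h _

/-- The chain lemmas require unit row sums at every natural time; the identity matrix used from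
`𝒟.T` onwards supplies them. -/
theorem sum_transitionWeight (h : ∀ k, IsThresholdVector (θ.γ k)) (n : Fin 𝒟.N) (t : ℕ)
    (u : 𝒟.State) : ∑ v, θ.transitionWeight n t u v = 1 := by
  unfold transitionWeight
  by_cases ht : t < 𝒟.T
  · simpa [ht] using sum_transitionMatrix h n ⟨t, ht⟩ u
  · simp [ht, Matrix.one_apply]

theorem transitionWeight_val (n : Fin 𝒟.N) (t : Fin 𝒟.T) (u v : 𝒟.State) :
    θ.transitionWeight n t u v = θ.transitionMatrix n t u v := by
  simp [transitionWeight]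

theorem pathProb_eq_chainWeight (n : Fin 𝒟.N) (hT : 0 < 𝒟.T) (a : Fin 𝒟.T → 𝒟.State) :
    θ.pathProb n a = chainWeight (θ.initialProb n ⟨0, hT⟩) (θ.transitionWeight n) 𝒟.T a := by
  refine Finset.prod_congr rfl fun t _ => ?_
  by_cases ht : (t : ℕ) = 0
  · have : t = ⟨0, hT⟩ := Fin.ext ht
    subst this
    simp
  · rw [if_neg ht, if_neg ht, transitionWeight_val]

theorem stateProb_eq_chainMarginal (h : ∀ k, IsThresholdVector (θ.γ k)) (n : Fin 𝒟.N)
    (hT : 0 < 𝒟.T) (t : Fin 𝒟.T) (u : 𝒟.State) :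
    θ.stateProb n t u =
      chainMarginal (θ.initialProb n ⟨0, hT⟩) (θ.transitionWeight n) t u := by
  have := sum_chainWeight_coord (θ.initialProb n ⟨0, hT⟩) (θ.transitionWeight n)
    (sum_transitionWeight h n) 𝒟.T t t.2 fun w => if w = u then 1 else 0
  simp only [mul_ite, mul_one, mul_zero, Finset.sum_ite_eq', Finset.mem_univ, if_true] at this
  rw [← this, stateProb, Finset.sum_filter]
  simp only [pathProb_eq_chainWeight n hT]

theorem stateProb_succ (h : ∀ k, IsThresholdVector (θ.γ k)) (n : Fin 𝒟.N) {t₀ t₁ : Fin 𝒟.T}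
    (h₁ : (t₁ : ℕ) = t₀ + 1) (v : 𝒟.State) :
    θ.stateProb n t₁ v = ∑ u, θ.stateProb n t₀ u * θ.transitionMatrix n t₁ u v := by
  have hT : 0 < 𝒟.T := t₀.pos
  simp only [stateProb_eq_chainMarginal h n hT, ← transitionWeight_val, h₁]
  exact chainMarginal_succ _ _ _ _

theorem sum_jointProb (h : ∀ j, IsThresholdVector (θ.κ j)) (n : Fin 𝒟.N) {t₀ t₁ t₂ : Fin 𝒟.T}
    (h₁ : t₀ ≠ t₁) (h₂ : t₀ ≠ t₂) (h₃ : t₁ ≠ t₂) (z : 𝒟.Response × 𝒟.Response × 𝒟.Response)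
    (a : Fin 𝒟.T → 𝒟.State) :
    ∑ y : Fin 𝒟.T → 𝒟.Response with y t₀ = z.1 ∧ y t₁ = z.2.1 ∧ y t₂ = z.2.2,
        θ.jointProb n a y =
      θ.pathProb n a * (θ.emissionProb z.1 (a t₀) * θ.emissionProb z.2.1 (a t₁) *
        θ.emissionProb z.2.2 (a t₂)) := by
  have := sum_filter_prod_eq_prod (fun t y => θ.emissionProb y (a t)) {t₀, t₁, t₂}
    (fun t => if t = t₀ then z.1 else if t = t₁ then z.2.1 else z.2.2)
    (fun t _ => sum_emissionProb h (a t))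
  rw [Finset.prod_insert (by simp [h₁, h₂]), Finset.prod_pair h₃] at this
  simp only [Finset.mem_insert, Finset.mem_singleton, forall_eq_or_imp, forall_eq, h₁.symm,
    h₂.symm, h₃.symm, if_true, if_false] at this
  simp only [jointProb]
  rw [← Finset.mul_sum, this, mul_assoc]

theorem threeTimeLaw_eq (h : θ.IsAdmissible) (n : Fin 𝒟.N) {t₀ t₁ t₂ : Fin 𝒟.T}
    (h₁ : (t₁ : ℕ) = t₀ + 1) (h₂ : (t₂ : ℕ) = t₁ + 1)
    (z : 𝒟.Response × 𝒟.Response × 𝒟.Response) :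
    θ.threeTimeLaw n t₀ t₁ t₂ z =
      ∑ u, θ.stateProb n t₀ u * ∑ v, θ.transitionMatrix n t₁ u v *
        ∑ w, θ.transitionMatrix n t₂ v w *
          (θ.emissionProb z.1 u * θ.emissionProb z.2.1 v * θ.emissionProb z.2.2 w) := by
  have hT : 0 < 𝒟.T := t₀.pos
  have hm : (t₀ : ℕ) + 2 < 𝒟.T := by have := t₂.2; omega
  have e1 : t₁ = ⟨(t₀ : ℕ) + 1, by omega⟩ := Fin.ext h₁
  have e2 : t₂ = ⟨(t₀ : ℕ) + 2, hm⟩ := Fin.ext (by simp [h₂, h₁])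
  have key := sum_chainWeight_three (θ.initialProb n ⟨0, hT⟩) (θ.transitionWeight n)
    (sum_transitionWeight h.γ_threshold n) 𝒟.T t₀ hm fun u v w =>
      θ.emissionProb z.1 u * θ.emissionProb z.2.1 v * θ.emissionProb z.2.2 w
  have n1 : t₀ ≠ t₁ := fun e => by rw [e] at h₁; omega
  have n2 : t₀ ≠ t₂ := fun e => by rw [← e] at h₂; omega
  have n3 : t₁ ≠ t₂ := fun e => by rw [e] at h₂; omega
  simp only [threeTimeLaw, sum_jointProb h.κ_threshold n n1 n2 n3, pathProb_eq_chainWeight n hT,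
    stateProb_eq_chainMarginal h.γ_threshold n hT, ← transitionWeight_val]
  rw [show (t₂ : ℕ) = t₀ + 2 by omega, h₁]
  rw [← key]
  simp only [e1, e2, Fin.eta]

/-! ### The factors of the three-time law -/

/-- The matrix `(p(Y^{t₀} = y, α^{t₁} = v))`. -/
noncomputable def pastMatrix (θ : 𝒟.Param) (n : Fin 𝒟.N) (t₀ t₁ : Fin 𝒟.T) :
    Matrix 𝒟.Response 𝒟.State ℝ :=
  θ.fullResponseMatrix * (Matrix.diagonal (θ.stateProb n t₀) * θ.transitionMatrix n t₁)

/-- The matrix `(p(Y^{t₂} = y | α^{t₁} = v))`. -/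
noncomputable def futureMatrix (θ : 𝒟.Param) (n : Fin 𝒟.N) (t₂ : Fin 𝒟.T) :
    Matrix 𝒟.Response 𝒟.State ℝ :=
  θ.fullResponseMatrix * (θ.transitionMatrix n t₂).transpose

theorem pastMatrix_apply (n : Fin 𝒟.N) (t₀ t₁ : Fin 𝒟.T) (y : 𝒟.Response) (v : 𝒟.State) :
    θ.pastMatrix n t₀ t₁ y v =
      ∑ u, θ.emissionProb y u * (θ.stateProb n t₀ u * θ.transitionMatrix n t₁ u v) := by
  rw [pastMatrix, Matrix.mul_apply]
  simp only [Matrix.diagonal_mul]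
  rfl

theorem threeTimeLaw_eq_sum_mul (h : θ.IsAdmissible) (n : Fin 𝒟.N) {t₀ t₁ t₂ : Fin 𝒟.T}
    (h₁ : (t₁ : ℕ) = t₀ + 1) (h₂ : (t₂ : ℕ) = t₁ + 1) (y y' y'' : 𝒟.Response) :
    θ.threeTimeLaw n t₀ t₁ t₂ (y, y', y'') =
      ∑ v, θ.pastMatrix n t₀ t₁ y v * θ.fullResponseMatrix y' v * θ.futureMatrix n t₂ y'' v := by
  rw [threeTimeLaw_eq h n h₁ h₂]
  simp only [pastMatrix_apply, futureMatrix, Matrix.mul_apply,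
    Matrix.transpose_apply, fullResponseMatrix, Matrix.of_apply, Finset.mul_sum, Finset.sum_mul]
  rw [Finset.sum_comm]
  refine Finset.sum_congr rfl fun v _ => ?_
  rw [Finset.sum_comm]
  refine Finset.sum_congr rfl fun w _ => Finset.sum_congr rfl fun u _ => ?_
  ring

theorem sum_fullResponseMatrix_mul (h : ∀ j, IsThresholdVector (θ.κ j))
    (W : Matrix 𝒟.State 𝒟.State ℝ) (v : 𝒟.State) :
    ∑ y, (θ.fullResponseMatrix * W) y v = ∑ u, W u v := by
  simp only [Matrix.mul_apply]
  rw [Finset.sum_comm]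
  refine Finset.sum_congr rfl fun u _ => ?_
  rw [← Finset.sum_mul]
  simp [fullResponseMatrix, sum_emissionProb h]

theorem sum_futureMatrix (h : θ.IsAdmissible) (n : Fin 𝒟.N) (t₂ : Fin 𝒟.T) (v : 𝒟.State) :
    ∑ y, θ.futureMatrix n t₂ y v = 1 := by
  rw [futureMatrix, sum_fullResponseMatrix_mul h.κ_threshold]
  exact sum_transitionMatrix h.γ_threshold n t₂ v

/-- Makes the column sums of the past factor positive, and later recovers the current state law. -/
theorem sum_pastMatrix (h : θ.IsAdmissible) (n : Fin 𝒟.N) {t₀ t₁ : Fin 𝒟.T}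
    (h₁ : (t₁ : ℕ) = t₀ + 1) (v : 𝒟.State) :
    ∑ y, θ.pastMatrix n t₀ t₁ y v = θ.stateProb n t₁ v := by
  rw [pastMatrix, sum_fullResponseMatrix_mul h.κ_threshold, stateProb_succ h.γ_threshold n h₁]
  simp only [Matrix.diagonal_mul]

theorem exists_mul_transitionMatrix_eq_one (hU : θ.FullRankTransitions) (n : Fin 𝒟.N)
    {t : Fin 𝒟.T} (ht : (t : ℕ) ≠ 0) :
    ∃ V : Matrix 𝒟.State 𝒟.State ℝ, V * θ.transitionMatrix n t = 1 :=
  Matrix.exists_mul_eq_one_of_rank_eq_card ((hU n t ht).trans (card_state 𝒟).symm)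

theorem exists_mul_futureMatrix_eq_one (h : θ ∈ 𝒟.paramSpace) (n : Fin 𝒟.N)
    {t : Fin 𝒟.T} (ht : (t : ℕ) ≠ 0) :
    ∃ X : Matrix 𝒟.State 𝒟.Response ℝ, X * θ.futureMatrix n t = 1 := by
  obtain ⟨hA, -, hB, hU⟩ := h
  obtain ⟨X, hX⟩ := exists_mul_fullResponseMatrix_eq_one hA.κ_threshold hB
  obtain ⟨V, hV⟩ := exists_mul_transitionMatrix_eq_one hU n ht
  refine ⟨V.transpose * X, ?_⟩
  rw [futureMatrix, Matrix.mul_assoc, ← Matrix.mul_assoc X, hX, Matrix.one_mul,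
    ← Matrix.transpose_mul, mul_eq_one_comm.mp hV, Matrix.transpose_one]

theorem exists_mul_pastMatrix_eq_one (h : θ ∈ 𝒟.paramSpace) (n : Fin 𝒟.N)
    (t₀ : Fin 𝒟.T) {t₁ : Fin 𝒟.T} (ht : (t₁ : ℕ) ≠ 0) :
    ∃ X : Matrix 𝒟.State 𝒟.Response ℝ, X * θ.pastMatrix n t₀ t₁ = 1 := by
  obtain ⟨hA, hpos, hB, hU⟩ := h
  obtain ⟨X, hX⟩ := exists_mul_fullResponseMatrix_eq_one hA.κ_threshold hB
  obtain ⟨V, hV⟩ := exists_mul_transitionMatrix_eq_one hU n ht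
  have hD : Matrix.diagonal (fun u => (θ.stateProb n t₀ u)⁻¹) *
      Matrix.diagonal (θ.stateProb n t₀) = 1 := by
    rw [Matrix.diagonal_mul_diagonal, ← Matrix.diagonal_one]
    congr 1
    exact funext fun u => inv_mul_cancel₀ (hpos n t₀ u).ne'
  refine ⟨V * Matrix.diagonal (fun u => (θ.stateProb n t₀ u)⁻¹) * X, ?_⟩
  calc _ = V * (Matrix.diagonal (fun u => (θ.stateProb n t₀ u)⁻¹) * (X * θ.fullResponseMatrix) *
        Matrix.diagonal (θ.stateProb n t₀)) * θ.transitionMatrix n t₁ := by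
        simp only [pastMatrix, Matrix.mul_assoc]
    _ = 1 := by rw [hX, Matrix.mul_one, hD, Matrix.mul_one, hV]

/-- A common relabelling of `E` and `E * W` is a relabelling of the rows and columns of `W`. -/
theorem eq_submatrix_of_mul_eq_submatrix {Y S : Type*} [Fintype Y] [Fintype S] [DecidableEq S]
    {E E' : Matrix Y S ℝ} {W W' : Matrix S S ℝ} {σ : Equiv.Perm S}
    (hE : ∃ X : Matrix S Y ℝ, X * E' = 1) (h : E' = E.submatrix id σ)
    (hW : E' * W' = (E * W).submatrix id σ) : W' = W.submatrix σ σ := by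
  obtain ⟨X, hX⟩ := hE
  have h2 : (E * W).submatrix id σ = E' * W.submatrix σ σ := by
    rw [h, Matrix.submatrix_mul_equiv]
  have := congrArg (X * ·) (hW.trans h2)
  simpa only [← Matrix.mul_assoc, hX, Matrix.one_mul] using this

end LongitudinalDesign.Param

/-! ### Reading the tuple off the matched factors -/

open LongitudinalDesign.Param in
theorem mainTheorem2 (𝒟 : LongitudinalDesign) (n : Fin 𝒟.N) (t₀ t₁ t₂ : Fin 𝒟.T)
    (h₁ : (t₁ : ℕ) = t₀ + 1) (h₂ : (t₂ : ℕ) = t₁ + 1) :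
    StrictlyIdentifiable 𝒟.paramSpace
      (fun θ => θ.threeTimeLaw n t₀ t₁ t₂)
      (fun θ => θ.localTuple n t₀ t₁ t₂)
      𝒟.labelSwap := by
  intro θ hθ θ' hθ' hlaw
  obtain ⟨hA, hpos, hB, hU⟩ := id hθ
  obtain ⟨hA', -, hB', -⟩ := id hθ'
  obtain ⟨σ, hF, hE, hG⟩ := exists_perm_of_triple_decomposition
    (exists_mul_pastMatrix_eq_one hθ n t₀ (t₁ := t₁) (by omega))
    (exists_mul_fullResponseMatrix_eq_one hA.κ_threshold hB)
    (exists_mul_futureMatrix_eq_one hθ n (t := t₂) (by omega))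
    (exists_mul_fullResponseMatrix_eq_one hA'.κ_threshold hB')
    (sum_emissionProb hA.κ_threshold) (sum_emissionProb hA'.κ_threshold)
    (sum_futureMatrix hA n t₂) (sum_futureMatrix hA' n t₂)
    (fun v => (hpos n t₁ v).trans_eq (sum_pastMatrix hA n h₁ v).symm)
    (fun y y' y'' =>
      (threeTimeLaw_eq_sum_mul hA n h₁ h₂ y y' y'').symm.trans
        ((hlaw (y, y', y'')).trans (threeTimeLaw_eq_sum_mul hA' n h₁ h₂ y y' y'')))
  have hE'inj := exists_mul_fullResponseMatrix_eq_one hA'.κ_threshold hB'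
  have hpast := eq_submatrix_of_mul_eq_submatrix hE'inj hE hF
  have hnext : θ'.transitionMatrix n t₂ = (θ.transitionMatrix n t₂).submatrix σ σ := by
    have := eq_submatrix_of_mul_eq_submatrix hE'inj hE hG
    rwa [← Matrix.transpose_submatrix, Matrix.transpose_inj] at this
  have hentry : ∀ u v, θ'.stateProb n t₀ u * θ'.transitionMatrix n t₁ u v =
      θ.stateProb n t₀ (σ u) * θ.transitionMatrix n t₁ (σ u) (σ v) := by
    intro u v
    simpa [Matrix.diagonal_mul] using congrFun (congrFun hpast u) v
  -- Transition rows sum to one, so summing over `v` separates the state law from the transition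
  -- matrix.
  have hprev : ∀ u, θ'.stateProb n t₀ u = θ.stateProb n t₀ (σ u) := by
    intro u
    have := Finset.sum_congr rfl fun v (_ : v ∈ Finset.univ) => hentry u v
    rwa [← Finset.mul_sum, ← Finset.mul_sum, Equiv.sum_comp σ (θ.transitionMatrix n t₁ (σ u)),
      sum_transitionMatrix hA.γ_threshold, sum_transitionMatrix hA'.γ_threshold, mul_one,
      mul_one] at this
  refine ⟨σ, ?_, hnext, ?_, funext hprev, ?_⟩
  · ext u v
    have := hentry u v
    rw [hprev] at this
    exact mul_left_cancel₀ (hpos n t₀ (σ u)).ne' this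
  · ext ⟨j, m⟩ u
    change θ'.itemProb j m u = θ.itemProb j m (σ u)
    rw [← sum_emissionProb_item hA.κ_threshold, ← sum_emissionProb_item hA'.κ_threshold]
    exact Finset.sum_congr rfl fun y _ => congrFun (congrFun hE y) u
  · ext v
    change θ'.stateProb n t₁ v = θ.stateProb n t₁ (σ v)
    rw [← sum_pastMatrix hA n h₁, ← sum_pastMatrix hA' n h₁]
    exact Finset.sum_congr rfl fun y _ => congrFun (congrFun hF y) v
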